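/- Let $\mathcal R$ be a finite factor, that is, a von Neumann algebra on a complex Hilbert space whose center is $\mathbb C 1$ and in which every isometry is unitary, and let $\mathrm{tr}$ be its trace, i.e. its unique normal tracial state. Every $x\in\mathcal R$ is regarded as the element $\mathrm{tr}(\,\cdot\,x)$ of the predual $\mathcal R_*$. Let $n\ge 1$, let $e_1,\dots,e_n$ be the standard basis of the $C^*$-algebra $\ell_\infty^n=\mathbb C^n$, and let $u_1,\dots,u_n\in\mathcal R$ be arbitrary unitaries. Then $$\Big\|\sum_{k=1}^n e_k\otimes u_k\Big\|_{\ell_\infty^n\otimes_\Delta\mathcal R_*}=1 .$$ Here the norm is defined as follows. Let $V$ and $W$ be matrix regular operator spaces, such as $C^*$-algebras and preduals of von Neumann algebras, with matrix norms on $M_k(V)$, $M_l(W)$ and positive cones $M_k(V)^+$, $M_l(W)^+$. Let $M_n(V\otimes_\Delta W)_+$ be the set of all $\alpha(v\otimes w)\alpha^*\in M_n(V\otimes W)$ with $k,l\in\mathbb N$, $v\in M_k(V)^+$, $w\in M_l(W)^+$ and $\alpha\in M_{n,kl}(\mathbb C)$. For $u\in M_n(V\otimes_\Delta W)_+$ put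 $|u|_\Delta=\inf\|\alpha\|^2\|v\|\|w\|$, where the infimum is over all such representations $u=\alpha(v\otimes w)\alpha^*$, and for $z\in M_n(V\otimes W)$ put $$\|z\|_{\Delta}=\inf\Big\{\max\{|u|_\Delta,|u'|_\Delta\} : u,u'\in M_n(V\otimes_\Delta W)_+,\ \begin{pmatrix}u&z\\ z^*&u'\end{pmatrix}\in M_{2n}(V\otimes_\Delta W)_+\Big\};$$ the norm of $V\otimes_\Delta W$ is the case of $1\times 1$ matrices. The space $\ell_\infty^n$ has the matrix norms and cones of the $C^*$-algebras $M_k(\ell_\infty^n)$. For $\mathcal R_*$, an element $[\varphi_{ij}]$ of $M_k(\mathcal R_*)$ is identified with the map $\mathcal R\to M_k$, $x\mapsto[\varphi_{ij}(x)]$; its norm is the completely bounded norm of this map, and it is positive if this map is completely positive. -/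

import Mathlib

noncomputable section

namespace DeltaTensor

-- Norms of scalar matrices are the operator norms between Euclidean spaces.
open scoped TensorProduct ComplexOrder InnerProductSpace Matrix.Norms.L2Operator

/-! ### Matrix norms and matrix cones, and the tensor norm `Δ` -/

/-- A family of norms on the spaces `M_k(V)` together with a family of cones `M_k(V)⁺`. It only
serves to package the two families of a given matrix ordered operator space. -/
structure MatrixNormCone (V : Type*) where
  /-- the norm of `M_k(V)` -/
  norm : ∀ k : ℕ, Matrix (Fin k) (Fin k) V → ℝ
  /-- the cone `M_k(V)⁺` -/
  pos : ∀ k : ℕ, Set (Matrix (Fin k) (Fin k) V)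

section DeltaNorm

variable {V W : Type*} [AddCommGroup V] [Module ℂ V] [AddCommGroup W] [Module ℂ W]

/-- The matrix `v ⊗ w ∈ M_{kl}(V ⊗ W)` for `v ∈ M_k(V)`, `w ∈ M_l(W)`. -/
def tmulMatrix {k l : ℕ} (v : Matrix (Fin k) (Fin k) V) (w : Matrix (Fin l) (Fin l) W) :
    Matrix (Fin k × Fin l) (Fin k × Fin l) (V ⊗[ℂ] W) :=
  Matrix.of fun s t => v s.1 t.1 ⊗ₜ[ℂ] w s.2 t.2

/-- The product `α x α*` of a vector-valued matrix `x` with a scalar matrix `α`. -/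
def compress {ι κ E : Type*} [Fintype κ] [AddCommGroup E] [Module ℂ E]
    (α : Matrix ι κ ℂ) (x : Matrix κ κ E) : Matrix ι ι E :=
  Matrix.of fun p q => ∑ s, ∑ t, (α p s * star (α q t)) • x s t

/-- The cone `M_ι(V ⊗_Δ W)_+` of all `α (v ⊗ w) α*` with `v ∈ M_k(V)⁺`, `w ∈ M_l(W)⁺`. -/
def deltaCone (𝓥 : MatrixNormCone V) (𝓦 : MatrixNormCone W) (ι : Type*) :
    Set (Matrix ι ι (V ⊗[ℂ] W)) :=
  {z | ∃ (k l : ℕ) (v : Matrix (Fin k) (Fin k) V) (w : Matrix (Fin l) (Fin l) W)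
      (α : Matrix ι (Fin k × Fin l) ℂ),
      v ∈ 𝓥.pos k ∧ w ∈ 𝓦.pos l ∧ z = compress α (tmulMatrix v w)}

/-- `|u|_Δ = inf ‖α‖² ‖v‖ ‖w‖` over all representations `u = α (v ⊗ w) α*` with `v`, `w`
positive. -/
def deltaAbs (𝓥 : MatrixNormCone V) (𝓦 : MatrixNormCone W) {ι : Type*} [Fintype ι]
    (u : Matrix ι ι (V ⊗[ℂ] W)) : ℝ :=
  sInf {r | ∃ (k l : ℕ) (v : Matrix (Fin k) (Fin k) V) (w : Matrix (Fin l) (Fin l) W)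
      (α : Matrix ι (Fin k × Fin l) ℂ),
      v ∈ 𝓥.pos k ∧ w ∈ 𝓦.pos l ∧ u = compress α (tmulMatrix v w) ∧
        r = ‖α‖ ^ 2 * 𝓥.norm k v * 𝓦.norm l w}

/-- The norm of `M_ι(V ⊗_Δ W)`: the infimum of `max (|u|_Δ) (|u'|_Δ)` over all `u`, `u'` in the
cone such that the block matrix with rows `u, z` and `z*, u'` is in the cone. The involution of
`V ⊗ W` is the one with `(x ⊗ y)* = x* ⊗ y*`. -/
def matrixDeltaNorm [StarAddMonoid V] [StarModule ℂ V] [StarAddMonoid W] [StarModule ℂ W]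
    (𝓥 : MatrixNormCone V) (𝓦 : MatrixNormCone W) {ι : Type*} [Fintype ι]
    (z : Matrix ι ι (V ⊗[ℂ] W)) : ℝ :=
  sInf {r | ∃ u u' : Matrix ι ι (V ⊗[ℂ] W),
      u ∈ deltaCone 𝓥 𝓦 ι ∧ u' ∈ deltaCone 𝓥 𝓦 ι ∧
      Matrix.fromBlocks u z z.conjTranspose u' ∈ deltaCone 𝓥 𝓦 (ι ⊕ ι) ∧
      r = max (deltaAbs 𝓥 𝓦 u) (deltaAbs 𝓥 𝓦 u')}

/-- The norm of `V ⊗_Δ W`, that is, the norm of `M_1(V ⊗_Δ W)`. -/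
def deltaNorm [StarAddMonoid V] [StarModule ℂ V] [StarAddMonoid W] [StarModule ℂ W]
    (𝓥 : MatrixNormCone V) (𝓦 : MatrixNormCone W) (z : V ⊗[ℂ] W) : ℝ :=
  matrixDeltaNorm 𝓥 𝓦 (Matrix.of fun _ _ : Fin 1 => z)

end DeltaNorm

/-! ### C*-algebras -/

/-- The norm of the C*-algebra `M_k(A)` over a C*-algebra `A`. -/
def cstarMatrixNorm (A : Type*) [CStarAlgebra A] (k : ℕ) (x : Matrix (Fin k) (Fin k) A) : ℝ :=
  letI := CStarAlgebra.spectralOrder A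
  letI := CStarAlgebra.spectralOrderedRing A
  ‖CStarMatrix.ofMatrix x‖

/-- The positive cone of the C*-algebra `M_k(A)` over a C*-algebra `A`. -/
def cstarMatrixPos (A : Type*) [CStarAlgebra A] (k : ℕ) : Set (Matrix (Fin k) (Fin k) A) :=
  {x | ∃ y : Matrix (Fin k) (Fin k) A, x = y.conjTranspose * y}

/-- The matrix norms and matrix cones of a C*-algebra. -/
def ofCStarAlgebra (A : Type*) [CStarAlgebra A] : MatrixNormCone A where
  norm := cstarMatrixNorm A
  pos := cstarMatrixPos A

/-! ### von Neumann algebras and their preduals -/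

section VonNeumann

universe u

variable {H : Type u} [NormedAddCommGroup H] [InnerProductSpace ℂ H] [CompleteSpace H]

theorem isClosed_vonNeumann (R : VonNeumannAlgebra H) :
    IsClosed (R.toStarSubalgebra : Set (H →L[ℂ] H)) := by
  have h : (R.toStarSubalgebra : Set (H →L[ℂ] H)) =
      Set.centralizer (Set.centralizer (R.toStarSubalgebra : Set (H →L[ℂ] H))) :=
    R.centralizer_centralizer'.symm
  rw [h]
  exact Set.isClosed_centralizer _

/-- A von Neumann algebra is a C*-algebra. -/
instance instCStarAlgebra (R : VonNeumannAlgebra H) : CStarAlgebra R.toStarSubalgebra :=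
  StarSubalgebra.cstarAlgebra R.toStarSubalgebra (h_closed := isClosed_vonNeumann R)

/-- A von Neumann algebra is a factor if its center consists of the scalars. -/
def IsFactor (R : VonNeumannAlgebra H) : Prop :=
  ∀ x : R.toStarSubalgebra, (∀ y, x * y = y * x) → ∃ c : ℂ, x = c • 1

/-- A von Neumann algebra is finite if each of its isometries is unitary. -/
def IsFinite (R : VonNeumannAlgebra H) : Prop :=
  ∀ v : R.toStarSubalgebra, star v * v = 1 → v * star v = 1

/-- The functional `x ↦ ⟪η, x ξ⟫` on a von Neumann algebra. -/
def vectorFunctional (R : VonNeumannAlgebra H) (ξ η : H) : StrongDual ℂ R.toStarSubalgebra :=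
  (innerSL ℂ η).comp ((ContinuousLinearMap.apply ℂ H ξ).comp
    (LinearMap.mkContinuous R.toStarSubalgebra.subtype.toLinearMap 1 (fun x => by simp)))

@[simp]
theorem vectorFunctional_apply (R : VonNeumannAlgebra H) (ξ η : H) (x : R.toStarSubalgebra) :
    vectorFunctional R ξ η x = ⟪η, (x : H →L[ℂ] H) ξ⟫_ℂ := rfl

/-- The predual `R_*` of a von Neumann algebra: the norm closed linear span, in the dual Banach
space, of the functionals `x ↦ ⟪η, x ξ⟫`; these are the ultraweakly continuous functionals. -/
def predual (R : VonNeumannAlgebra H) : Submodule ℂ (StrongDual ℂ R.toStarSubalgebra) :=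
  (Submodule.span ℂ
    (Set.range fun p : H × H => vectorFunctional R p.1 p.2)).topologicalClosure

/-- The adjoint `ω*(x) = conj (ω (x*))` of a functional on a von Neumann algebra. -/
def adjointFunctional (R : VonNeumannAlgebra H) (ω : StrongDual ℂ R.toStarSubalgebra) :
    StrongDual ℂ R.toStarSubalgebra where
  toFun x := star (ω (star x))
  map_add' x y := by simp
  map_smul' c x := by simp
  cont := continuous_star.comp (ω.continuous.comp continuous_star)

@[simp]
theorem adjointFunctional_apply (R : VonNeumannAlgebra H)
    (ω : StrongDual ℂ R.toStarSubalgebra) (x : R.toStarSubalgebra) :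
    adjointFunctional R ω x = star (ω (star x)) := rfl

/-- The functional `y ↦ ω (y x)`. -/
def translateFunctional (R : VonNeumannAlgebra H) (x : R.toStarSubalgebra)
    (ω : StrongDual ℂ R.toStarSubalgebra) : StrongDual ℂ R.toStarSubalgebra where
  toFun y := ω (y * x)
  map_add' y z := by simp [add_mul]
  map_smul' c y := by simp
  cont := ω.continuous.comp (continuous_id.mul continuous_const)

@[simp]
theorem translateFunctional_apply (R : VonNeumannAlgebra H) (x : R.toStarSubalgebra)
    (ω : StrongDual ℂ R.toStarSubalgebra) (y : R.toStarSubalgebra) :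
    translateFunctional R x ω y = ω (y * x) := rfl

theorem continuous_of_bound {R : VonNeumannAlgebra H} {σ : ℂ →+* ℂ}
    (f : StrongDual ℂ R.toStarSubalgebra →ₛₗ[σ] StrongDual ℂ R.toStarSubalgebra) (C : ℝ)
    (h : ∀ ω x, ‖f ω x‖ ≤ C * ‖ω‖ * ‖x‖) (hC : 0 ≤ C) : Continuous f :=
  AddMonoidHomClass.continuous_of_bound f C fun ω =>
    ContinuousLinearMap.opNorm_le_bound _ (by positivity) (h ω)

theorem mem_predual_of_semilinear {R : VonNeumannAlgebra H} {σ : ℂ →+* ℂ} [RingHomSurjective σ]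
    (f : StrongDual ℂ R.toStarSubalgebra →ₛₗ[σ] StrongDual ℂ R.toStarSubalgebra)
    (hf : Continuous f)
    (hv : ∀ ξ η : H, ∃ ξ' η' : H, f (vectorFunctional R ξ η) = vectorFunctional R ξ' η')
    {ω : StrongDual ℂ R.toStarSubalgebra} (hω : ω ∈ predual R) : f ω ∈ predual R := by
  refine map_mem_closure hf hω fun φ hφ => ?_
  have h := Submodule.mem_map_of_mem (f := f) hφ
  rw [Submodule.map_span] at h
  refine Submodule.span_mono ?_ h
  rintro _ ⟨_, ⟨p, rfl⟩, rfl⟩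
  obtain ⟨ξ, η, h'⟩ := hv p.1 p.2
  exact ⟨(ξ, η), h'.symm⟩

theorem adjointFunctional_mem (R : VonNeumannAlgebra H)
    {ω : StrongDual ℂ R.toStarSubalgebra} (hω : ω ∈ predual R) :
    adjointFunctional R ω ∈ predual R := by
  let f : StrongDual ℂ R.toStarSubalgebra →ₗ⋆[ℂ] StrongDual ℂ R.toStarSubalgebra :=
    { toFun := adjointFunctional R
      map_add' := fun φ ψ => by ext x; simp
      map_smul' := fun c φ => by ext x; simp }
  refine mem_predual_of_semilinear f (continuous_of_bound f 1 (fun φ x => ?_) zero_le_one)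
    (fun ξ η => ⟨η, ξ, ?_⟩) hω
  · change ‖star (φ (star x))‖ ≤ 1 * ‖φ‖ * ‖x‖
    rw [norm_star, one_mul, ← norm_star x]
    exact φ.le_opNorm _
  · ext x
    change star ⟪η, ((star x : R.toStarSubalgebra) : H →L[ℂ] H) ξ⟫_ℂ =
      ⟪ξ, (x : H →L[ℂ] H) η⟫_ℂ
    rw [StarMemClass.coe_star, ContinuousLinearMap.star_eq_adjoint,
      ContinuousLinearMap.adjoint_inner_right]
    exact inner_conj_symm _ _

theorem translateFunctional_mem (R : VonNeumannAlgebra H) (x : R.toStarSubalgebra)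
    {ω : StrongDual ℂ R.toStarSubalgebra} (hω : ω ∈ predual R) :
    translateFunctional R x ω ∈ predual R := by
  let f : StrongDual ℂ R.toStarSubalgebra →ₗ[ℂ] StrongDual ℂ R.toStarSubalgebra :=
    { toFun := translateFunctional R x
      map_add' := fun φ ψ => by ext y; simp
      map_smul' := fun c φ => by ext y; simp }
  refine mem_predual_of_semilinear f
    (continuous_of_bound f ‖x‖ (fun φ y => ?_) (norm_nonneg x))
    (fun ξ η => ⟨(x : H →L[ℂ] H) ξ, η, ?_⟩) hω
  · change ‖φ (y * x)‖ ≤ ‖x‖ * ‖φ‖ * ‖y‖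
    calc ‖φ (y * x)‖ ≤ ‖φ‖ * ‖y * x‖ := φ.le_opNorm _
      _ ≤ ‖φ‖ * (‖y‖ * ‖x‖) := by gcongr; exact norm_mul_le _ _
      _ = ‖x‖ * ‖φ‖ * ‖y‖ := by ring
  · ext y
    rfl

/-- The involution of the predual. -/
instance instStarAddMonoidPredual (R : VonNeumannAlgebra H) : StarAddMonoid (predual R) where
  star ω := ⟨adjointFunctional R ω, adjointFunctional_mem R ω.2⟩
  star_involutive ω := by ext x; simp
  star_add ω φ := by ext x; simp

@[simp]
theorem star_predual_apply (R : VonNeumannAlgebra H) (ω : predual R) (x : R.toStarSubalgebra) :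
    (star ω : predual R).1 x = star (ω.1 (star x)) := rfl

instance instStarModulePredual (R : VonNeumannAlgebra H) : StarModule ℂ (predual R) where
  star_smul c ω := by ext x; simp

/-- For `φ = [φ_ij] ∈ M_k(R_*)`, regarded as the map `R → M_k`, `x ↦ [φ_ij(x)]`, and
`x = [x_ab] ∈ M_m(R)`, the image `[φ_ij(x_ab)] ∈ M_m(M_k)` of `x` under the amplified map. -/
def amplify {R : VonNeumannAlgebra H} {k m : ℕ} (φ : Matrix (Fin k) (Fin k) (predual R))
    (x : Matrix (Fin m) (Fin m) R.toStarSubalgebra) :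
    Matrix (Fin m × Fin k) (Fin m × Fin k) ℂ :=
  Matrix.of fun s t => (φ s.2 t.2).1 (x s.1 t.1)

/-- The matrix norms and matrix cones of the predual, as a subspace of the operator space dual:
the norm of `M_k(R_*)` is the completely bounded norm of maps `R → M_k`, and `M_k(R_*)⁺` consists
of the completely positive maps. -/
def ofPredual (R : VonNeumannAlgebra H) : MatrixNormCone (predual R) where
  norm _ φ := sInf {C : ℝ | 0 ≤ C ∧ ∀ (m : ℕ) (x : Matrix (Fin m) (Fin m) R.toStarSubalgebra),
    ‖amplify φ x‖ ≤ C * cstarMatrixNorm R.toStarSubalgebra m x}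
  pos _ := {φ | ∀ (m : ℕ), ∀ x ∈ cstarMatrixPos R.toStarSubalgebra m, (amplify φ x).PosSemidef}

/-- An element `tr` of the predual (a normal functional) is a tracial state. A finite factor has
exactly one normal tracial state, its trace. -/
structure IsTracialState {R : VonNeumannAlgebra H} (tr : predual R) : Prop where
  pos : ∀ x : R.toStarSubalgebra, 0 ≤ tr.1 (star x * x)
  map_one : tr.1 1 = 1
  map_mul_comm : ∀ x y : R.toStarSubalgebra, tr.1 (x * y) = tr.1 (y * x)

/-- The element `tr(· x)` of the predual given by an element `x` of the von Neumann algebra. -/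
def toPredual {R : VonNeumannAlgebra H} (tr : predual R) (x : R.toStarSubalgebra) : predual R :=
  ⟨translateFunctional R x tr, translateFunctional_mem R x tr.2⟩

end VonNeumann

end DeltaTensor

end

noncomputable section

namespace DeltaTensor

open scoped TensorProduct ComplexOrder InnerProductSpace Matrix.Norms.L2Operator
open Matrix WithLp

/-! ### Operator norms tested on scalar vectors. -/

section Matrices

/-! Write `z = ∑ e_k ⊗ tr(· u_k)`. Both bounds use the same majorant `1 ⊗ tr` or its slices. Upper
bound: put `u = u' = 1 ⊗ tr`. With `d_0 = 1` and `d_{k+1} = u_k`, traciality makes the matrix `[tr(·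
d_j d_i*)]` completely positive (`mul_star_mem_pos`). Tensoring it with the positive diagonal matrix
`diag(e_k)` and selecting the entries with indices `0` and `k+1` over each `e_k` gives exactly the
block matrix of `1 ⊗ tr` and `z`, because `u_k u_k* = 1` (`fromBlocks_mem_deltaCone`). This
representation needs no norm control: only the diagonal blocks count, and `|1 ⊗ tr|_Δ ≤ 1` since
`‖tr‖ ≤ 1`. Lower bound: for an admissible pair `u, u'`, evaluate the `ℓ_∞`-leg at a coordinate `r`.
The block matrix becomes a completely positive matrix of functionals with diagonal `φ, φ'` and
corner `tr(· u_r)` (`sum_sliceAt_nonneg`). Testing it on `(1, -u_r*)` gives `φ(1) + φ'(1) ≥ 2`,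
while `φ(1)` and `φ'(1)` have modulus at most `|u|_Δ` and `|u'|_Δ`
(`norm_sliceAt_apply_one_le_deltaAbs`). -/

-- The norm of `M_k(A)` is the operator norm on the Hilbert module `A^k`; scalar multiples of `1`
-- embed `ℂ^k` contractively in it, and Cauchy–Schwarz applies.
open WithCStarModule in
theorem norm_sum_smul_le_cstarMatrixNorm {A : Type*} [CStarAlgebra A] {k : ℕ}
    (x : Matrix (Fin k) (Fin k) A) (c d : Fin k → ℂ) :
    ‖∑ i, ∑ j, (star (c i) * d j) • x i j‖ ≤
      cstarMatrixNorm A k x * ‖toLp 2 c‖ * ‖toLp 2 d‖ := by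
  let _ := CStarAlgebra.spectralOrder A
  let _ := CStarAlgebra.spectralOrderedRing A
  have hone : ‖(1 : A)‖ ≤ 1 := by
    cases subsingleton_or_nontrivial A
    · simp [Subsingleton.elim (1 : A) 0]
    · exact CStarRing.norm_one.le
  -- The coefficients are conjugated because `CStarMatrix.toCLM` acts on row vectors.
  let vec : (Fin k → ℂ) → C⋆ᵐᵒᵈ(A, Fin k → A) := fun c =>
    (equiv A (Fin k → A)).symm fun i => star (c i) • (1 : A)
  have hvec : ∀ c : Fin k → ℂ, ‖vec c‖ ≤ ‖toLp 2 c‖ := fun c => by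
    have h : ‖vec c‖ ^ 2 ≤ ‖toLp 2 c‖ ^ 2 := by
      rw [pi_norm_sq, EuclideanSpace.norm_sq_eq]
      refine (norm_sum_le _ _).trans (Finset.sum_le_sum fun i _ => ?_)
      have : ⟪vec c i, vec c i⟫_A = (star (c i) * c i) • (1 : A) := by
        simp [vec, WithCStarModule.inner_def, smul_smul, mul_comm]
      rw [this, norm_smul, norm_mul, norm_star, ← sq]
      exact mul_le_of_le_one_right (by positivity) hone
    exact le_of_sq_le_sq h (norm_nonneg _)
  have hin : ⟪vec d, CStarMatrix.toCLM (CStarMatrix.ofMatrix x) (vec c)⟫_A =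
      ∑ i, ∑ j, (star (c i) * d j) • x i j := by
    simp only [pi_inner, WithCStarModule.inner_def, CStarMatrix.toCLM_apply_eq_sum]
    rw [Finset.sum_comm]
    refine Finset.sum_congr rfl fun j _ => ?_
    simp [vec, Finset.smul_sum, smul_smul, mul_comm]
  rw [← hin]
  refine (CStarModule.norm_inner_le _).trans ?_
  have := (CStarMatrix.toCLM (CStarMatrix.ofMatrix x)).le_opNorm (vec c)
  have hx : cstarMatrixNorm A k x = ‖CStarMatrix.toCLM (CStarMatrix.ofMatrix x)‖ := rfl
  rw [hx]
  calc _ ≤ ‖vec d‖ * (‖CStarMatrix.toCLM (CStarMatrix.ofMatrix x)‖ * ‖vec c‖) := by gcongr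
    _ ≤ ‖toLp 2 d‖ * (‖CStarMatrix.toCLM (CStarMatrix.ofMatrix x)‖ * ‖toLp 2 c‖) := by
      gcongr <;> apply hvec
    _ = _ := by ring

variable {κ ι : Type*} [Fintype κ] [DecidableEq κ] [Fintype ι]

theorem norm_dotProduct_mulVec_le (M : Matrix ι κ ℂ) (c : ι → ℂ) (d : κ → ℂ) :
    ‖star c ⬝ᵥ M *ᵥ d‖ ≤ ‖M‖ * ‖toLp 2 c‖ * ‖toLp 2 d‖ := by
  have h : star c ⬝ᵥ M *ᵥ d = ⟪toLp 2 c, toLp 2 (M *ᵥ d)⟫_ℂ := by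
    rw [EuclideanSpace.inner_toLp_toLp, dotProduct_comm]
  rw [h]
  have h1 := Matrix.l2_opNorm_mulVec M (toLp 2 d)
  calc _ ≤ ‖toLp 2 c‖ * ‖toLp 2 (M *ᵥ d)‖ := norm_inner_le_norm _ _
    _ ≤ ‖toLp 2 c‖ * (‖M‖ * ‖toLp 2 d‖) := by gcongr; exact h1
    _ = _ := by ring

theorem norm_le_of_forall_dotProduct_mulVec {M : Matrix ι κ ℂ} {C : ℝ} (hC : 0 ≤ C)
    (h : ∀ (c : ι → ℂ) (d : κ → ℂ),
      ‖star c ⬝ᵥ M *ᵥ d‖ ≤ C * ‖toLp 2 c‖ * ‖toLp 2 d‖) : ‖M‖ ≤ C := by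
  rw [Matrix.l2_opNorm_def]
  refine ContinuousLinearMap.opNorm_le_bound _ hC fun d => ?_
  -- The choice `c = M d` turns the form into `‖M d‖²`; one factor then cancels.
  have h2 := h (M *ᵥ (ofLp d)) (ofLp d)
  have h3 : star (M *ᵥ (ofLp d)) ⬝ᵥ M *ᵥ (ofLp d) =
      ⟪toLp 2 (M *ᵥ (ofLp d)), toLp 2 (M *ᵥ (ofLp d))⟫_ℂ := by
    rw [EuclideanSpace.inner_toLp_toLp, dotProduct_comm]
  rw [h3, inner_self_eq_norm_sq_to_K, norm_pow] at h2
  change ‖toLp 2 (M *ᵥ (ofLp d))‖ ≤ C * ‖d‖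
  simp only [RCLike.norm_ofReal, abs_norm, toLp_ofLp] at h2
  rcases (norm_nonneg (toLp 2 (M *ᵥ (ofLp d)))).eq_or_lt with h0 | h0
  · rw [← h0]; positivity
  · refine le_of_mul_le_mul_right ?_ h0
    linarith

theorem norm_entry_le_l2_opNorm [DecidableEq ι] (M : Matrix ι κ ℂ) (i : ι) (j : κ) : ‖M i j‖ ≤ ‖M‖ := by
  have h := norm_dotProduct_mulVec_le M (Pi.single i 1) (Pi.single j 1)
  simpa [← Pi.single_star] using h

-- `M ⊗ N = (M ⊗ 1)(1 ⊗ N)`, and the two embeddings are star homomorphisms, hence contractive.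
open Kronecker in
theorem l2_opNorm_kronecker_le [DecidableEq ι] (M : Matrix κ κ ℂ) (N : Matrix ι ι ℂ) :
    ‖M ⊗ₖ N‖ ≤ ‖M‖ * ‖N‖ := by
  let f : Matrix κ κ ℂ →⋆ₙₐ[ℂ] Matrix (κ × ι) (κ × ι) ℂ :=
    { toFun := fun M => M ⊗ₖ (1 : Matrix ι ι ℂ)
      map_smul' := fun c M => by simp [smul_kronecker]
      map_zero' := by simp
      map_add' := fun M N => by simp [add_kronecker]
      map_mul' := fun M N => by simp [← mul_kronecker_mul]
      map_star' := fun M => by simp [star_eq_conjTranspose, conjTranspose_kronecker] }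
  let g : Matrix ι ι ℂ →⋆ₙₐ[ℂ] Matrix (κ × ι) (κ × ι) ℂ :=
    { toFun := fun M => (1 : Matrix κ κ ℂ) ⊗ₖ M
      map_smul' := fun c M => by simp [kronecker_smul]
      map_zero' := by simp
      map_add' := fun M N => by simp [kronecker_add]
      map_mul' := fun M N => by simp [← mul_kronecker_mul]
      map_star' := fun M => by simp [star_eq_conjTranspose, conjTranspose_kronecker] }
  have h : M ⊗ₖ N = f M * g N := by
    change _ = (M ⊗ₖ (1 : Matrix ι ι ℂ)) * ((1 : Matrix κ κ ℂ) ⊗ₖ N)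
    simp [← mul_kronecker_mul]
  rw [h]
  refine (norm_mul_le _ _).trans ?_
  gcongr
  · exact NonUnitalStarAlgHom.norm_apply_le f M
  · exact NonUnitalStarAlgHom.norm_apply_le g N

end Matrices

/-! ### Matrix norms of C*-algebras and of the predual. -/

theorem cstarMatrixNorm_nonneg {A : Type*} [CStarAlgebra A] {k : ℕ}
    (x : Matrix (Fin k) (Fin k) A) : 0 ≤ cstarMatrixNorm A k x := by
  let _ := CStarAlgebra.spectralOrder A
  let _ := CStarAlgebra.spectralOrderedRing A
  exact norm_nonneg (CStarMatrix.ofMatrix x)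

theorem cstarMatrixNorm_one_le {A : Type*} [CStarAlgebra A] (k : ℕ) :
    cstarMatrixNorm A k 1 ≤ 1 := by
  let _ := CStarAlgebra.spectralOrder A
  let _ := CStarAlgebra.spectralOrderedRing A
  change ‖(1 : CStarMatrix (Fin k) (Fin k) A)‖ ≤ 1
  cases subsingleton_or_nontrivial (CStarMatrix (Fin k) (Fin k) A)
  · simp [Subsingleton.elim (1 : CStarMatrix (Fin k) (Fin k) A) 0]
  · exact CStarRing.norm_one.le

theorem one_mem_cstarMatrixPos (A : Type*) [CStarAlgebra A] (k : ℕ) :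
    1 ∈ cstarMatrixPos A k := ⟨1, by simp⟩

theorem norm_map_apply_le_cstarMatrixNorm {n k : ℕ} (v : Matrix (Fin k) (Fin k) (Fin n → ℂ))
    (r : Fin n) : ‖v.map (fun f => f r)‖ ≤ cstarMatrixNorm (Fin n → ℂ) k v := by
  refine norm_le_of_forall_dotProduct_mulVec (cstarMatrixNorm_nonneg v) fun c d => ?_
  refine le_trans ?_ (norm_sum_smul_le_cstarMatrixNorm v c d)
  refine le_trans (le_of_eq ?_) (norm_le_pi_norm _ r)
  congr 1
  simp [dotProduct, mulVec, Finset.mul_sum, mul_assoc, mul_comm]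

universe u
variable {H : Type u} [NormedAddCommGroup H] [InnerProductSpace ℂ H] [CompleteSpace H]
  {R : VonNeumannAlgebra H}

/-- A crude completely bounded estimate. It shows that the set defining the norm of `M_k(R_*)` is
nonempty, so that its `sInf` is not the default `0`; for a `1 × 1` matrix it is sharp enough for the
trace. -/
theorem norm_amplify_le {k m : ℕ} (φ : Matrix (Fin k) (Fin k) (predual R))
    (x : Matrix (Fin m) (Fin m) R.toStarSubalgebra) :
    ‖amplify φ x‖ ≤ (∑ i, ∑ j, ‖(φ i j).1‖) * cstarMatrixNorm R.toStarSubalgebra m x := by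
  have hx := cstarMatrixNorm_nonneg x
  refine norm_le_of_forall_dotProduct_mulVec (by positivity) fun c d => ?_
  have h : star c ⬝ᵥ amplify φ x *ᵥ d = ∑ i, ∑ j,
      (φ i j).1 (∑ a, ∑ b, (star (c (a, i)) * d (b, j)) • x a b) := by
    simp only [dotProduct, mulVec, Finset.mul_sum, map_sum, map_smul, Fintype.sum_prod_type,
      amplify, of_apply, smul_eq_mul]
    rw [Finset.sum_comm]
    refine Finset.sum_congr rfl fun i _ => ?_
    rw [Finset.sum_congr rfl fun a _ => Finset.sum_comm, Finset.sum_comm]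
    refine Finset.sum_congr rfl fun j _ => Finset.sum_congr rfl fun a _ =>
      Finset.sum_congr rfl fun b _ => ?_
    simp only [Pi.star_apply]
    ring
  have hslice : ∀ (c : Fin m × Fin k → ℂ) i, ‖toLp 2 fun a => c (a, i)‖ ≤ ‖toLp 2 c‖ := by
    intro c i
    refine le_of_sq_le_sq ?_ (norm_nonneg _)
    rw [EuclideanSpace.norm_sq_eq, EuclideanSpace.norm_sq_eq, Fintype.sum_prod_type]
    exact Finset.sum_le_sum fun a _ => Finset.single_le_sum
      (f := fun j => ‖c (a, j)‖ ^ 2) (fun j _ => by positivity) (Finset.mem_univ i)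
  rw [h]
  simp only [Finset.sum_mul]
  refine (norm_sum_le _ _).trans (Finset.sum_le_sum fun i _ => (norm_sum_le _ _).trans
    (Finset.sum_le_sum fun j _ => ?_))
  calc _ ≤ ‖(φ i j).1‖ * (cstarMatrixNorm R.toStarSubalgebra m x *
        ‖toLp 2 fun a => c (a, i)‖ * ‖toLp 2 fun b => d (b, j)‖) :=
        ((φ i j).1.le_opNorm _).trans (by
          gcongr; exact norm_sum_smul_le_cstarMatrixNorm x (fun a => c (a, i)) fun b => d (b, j))
    _ ≤ ‖(φ i j).1‖ * (cstarMatrixNorm R.toStarSubalgebra m x * ‖toLp 2 c‖ * ‖toLp 2 d‖) := by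
      gcongr <;> apply hslice
    _ = _ := by ring

theorem ofPredual_norm_nonneg {k : ℕ} (φ : Matrix (Fin k) (Fin k) (predual R)) :
    0 ≤ (ofPredual R).norm k φ := Real.sInf_nonneg fun _ h => h.1

theorem ofPredual_norm_le {k : ℕ} (φ : Matrix (Fin k) (Fin k) (predual R)) :
    (ofPredual R).norm k φ ≤ ∑ i, ∑ j, ‖(φ i j).1‖ :=
  csInf_le ⟨0, fun _ h => h.1⟩ ⟨by positivity, fun _ x => norm_amplify_le φ x⟩

theorem norm_apply_one_le_ofPredual_norm {k : ℕ} (φ : Matrix (Fin k) (Fin k) (predual R)) :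
    ‖φ.map fun ω => ω.1 1‖ ≤ (ofPredual R).norm k φ := by
  refine le_csInf ⟨_, by positivity, fun _ x => norm_amplify_le φ x⟩ fun C hC => ?_
  -- Only the unit of `M_1(R)` is tested.
  have h := (hC.2 1 1).trans (mul_le_of_le_one_right hC.1 (cstarMatrixNorm_one_le 1))
  refine norm_le_of_forall_dotProduct_mulVec hC.1 fun c d => ?_
  have h2 := norm_dotProduct_mulVec_le (amplify φ (1 : Matrix (Fin 1) (Fin 1) _))
    (fun p => c p.2) (fun p => d p.2)
  have hn : ∀ c : Fin k → ℂ, ‖toLp 2 fun p : Fin 1 × Fin k => c p.2‖ = ‖toLp 2 c‖ := by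
    intro c
    simp [EuclideanSpace.norm_eq, Fintype.sum_prod_type]
  rw [hn, hn] at h2
  refine le_trans (le_of_eq ?_) (h2.trans (by gcongr))
  simp [dotProduct, mulVec, Fintype.sum_prod_type, amplify]

/-! ### Slicing the cone at a coordinate of `ℓ_∞^n`. -/

/-- The linear map `f ⊗ ω ↦ f r • ω`. -/
def sliceAt {n : ℕ} (r : Fin n) : (Fin n → ℂ) ⊗[ℂ] predual R →ₗ[ℂ] predual R :=
  TensorProduct.lift (LinearMap.lsmul ℂ (predual R) ∘ₗ LinearMap.proj r)

@[simp]
theorem sliceAt_tmul {n : ℕ} (r : Fin n) (f : Fin n → ℂ) (ω : predual R) :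
    sliceAt r (f ⊗ₜ[ℂ] ω) = f r • ω := rfl

theorem sliceAt_compress_apply {n k l : ℕ} {ι : Type*} (r : Fin n)
    (α : Matrix ι (Fin k × Fin l) ℂ) (v : Matrix (Fin k) (Fin k) (Fin n → ℂ))
    (w : Matrix (Fin l) (Fin l) (predual R)) (p q : ι) (y : R.toStarSubalgebra) :
    (sliceAt r (compress α (tmulMatrix v w) p q) : predual R).1 y =
      ∑ s : Fin k × Fin l, ∑ t : Fin k × Fin l, α p s * star (α q t) * (v s.1 t.1 r * (w s.2 t.2).1 y) := by
  simp [compress, tmulMatrix]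

-- Slicing at `r` and evaluating at `1` are contractive on the matrix levels, and they turn `α (v ⊗
-- w) α*` into a product of scalar matrices.
open Kronecker in
theorem norm_sliceAt_apply_one_le_deltaAbs {n : ℕ} (r : Fin n)
    {ι : Type*} [Fintype ι] {u : Matrix ι ι ((Fin n → ℂ) ⊗[ℂ] predual R)}
    (hu : u ∈ deltaCone (ofCStarAlgebra (Fin n → ℂ)) (ofPredual R) ι) (p : ι) :
    ‖(sliceAt r (u p p) : predual R).1 1‖ ≤ deltaAbs (ofCStarAlgebra (Fin n → ℂ)) (ofPredual R) u := by
  classical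
  obtain ⟨k, l, v, w, α, hv, hw, h⟩ := hu
  -- Membership in the cone supplies a representation, without which the infimum would be the
  -- default `0`.
  refine le_csInf ⟨_, k, l, v, w, α, hv, hw, h, rfl⟩ fun x hx => ?_
  obtain ⟨k, l, v, w, α, -, -, hx, rfl⟩ := hx
  rw [hx]
  have h : (sliceAt r (compress α (tmulMatrix v w) p p) : predual R).1 1 =
      (α * ((v.map fun f => f r) ⊗ₖ (w.map fun ω => ω.1 1)) * αᴴ) p p := by
    rw [sliceAt_compress_apply]
    simp only [mul_apply, Finset.sum_mul]
    rw [Finset.sum_comm]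
    refine Finset.sum_congr rfl fun s _ => Finset.sum_congr rfl fun t _ => ?_
    simp [kroneckerMap_apply]
    ring
  rw [h]
  refine (norm_entry_le_l2_opNorm _ p p).trans ?_
  calc _ ≤ ‖α‖ * ‖(v.map fun f => f r) ⊗ₖ (w.map fun ω => ω.1 1)‖ * ‖αᴴ‖ :=
        (l2_opNorm_mul _ _).trans (by gcongr; exact l2_opNorm_mul _ _)
    _ ≤ ‖α‖ * (‖v.map fun f => f r‖ * ‖w.map fun ω => ω.1 1‖) * ‖αᴴ‖ := by
        gcongr; exact l2_opNorm_kronecker_le _ _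
    _ ≤ ‖α‖ * ((ofCStarAlgebra (Fin n → ℂ)).norm k v * (ofPredual R).norm l w) * ‖α‖ := by
        rw [l2_opNorm_conjTranspose]
        gcongr
        · exact cstarMatrixNorm_nonneg v
        · exact norm_map_apply_le_cstarMatrixNorm v r
        · exact norm_apply_one_le_ofPredual_norm w
    _ = _ := by ring

-- Complete positivity of a slice: its quadratic form is that of the Kronecker product of the
-- positive matrices `v(r)` and `[w_ij(y_a* y_b)]`.
open Kronecker in
theorem sum_sliceAt_nonneg {n m : ℕ} (r : Fin n) {ι : Type*}
    {M : Matrix ι ι ((Fin n → ℂ) ⊗[ℂ] predual R)}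
    (hM : M ∈ deltaCone (ofCStarAlgebra (Fin n → ℂ)) (ofPredual R) ι)
    (g : Fin m → ι) (y : Fin m → R.toStarSubalgebra) :
    0 ≤ ∑ a, ∑ b, (sliceAt r (M (g a) (g b)) : predual R).1 (star (y a) * y b) := by
  obtain ⟨k, l, v, w, α, ⟨V, rfl⟩, hw, rfl⟩ := hM
  have hV : ((Vᴴ * V).map fun f => f r).PosSemidef := by
    have : ((Vᴴ * V).map fun f => f r) = (V.map fun f => f r)ᴴ * (V.map fun f => f r) := by
      ext i j
      simp [mul_apply]
    rw [this]
    exact posSemidef_conjTranspose_mul_self _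
  cases m with
  | zero => simp
  | succ m =>
  -- Only row `0` is nonzero, so `Y* Y` has entries `y_a* y_b`; the case split ensures that this row
  -- exists.
  let Y : Matrix (Fin (m + 1)) (Fin (m + 1)) R.toStarSubalgebra :=
    of fun a b => if a = 0 then y b else 0
  have hY : ∀ a b, (Yᴴ * Y) a b = star (y a) * y b := fun a b => by
    simp [mul_apply, Y]
  have hK := (hV.kronecker (hw (m + 1) _ ⟨Y, rfl⟩)).dotProduct_mulVec_nonneg
    fun p => star (α (g p.2.1) (p.1, p.2.2))
  refine hK.trans_eq ?_
  simp only [sliceAt_compress_apply, dotProduct, mulVec, Finset.mul_sum, Fintype.sum_prod_type,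
    kroneckerMap_apply, amplify, of_apply, map_apply, hY, Pi.star_apply, star_star]
  rw [Finset.sum_comm]
  refine Finset.sum_congr rfl fun a _ => ?_
  refine Eq.trans (Finset.sum_congr rfl fun s _ => ?_) Finset.sum_comm
  refine Eq.trans (Finset.sum_congr rfl fun t _ => ?_) Finset.sum_comm
  refine Eq.trans (Finset.sum_congr rfl fun s' _ => ?_) Finset.sum_comm
  refine Finset.sum_congr rfl fun b _ => Finset.sum_congr rfl fun t' _ => ?_
  ring

/-! ### Ingredients of the explicit representation. -/

/-- The `0`-`1` matrix lets each block row `p` choose its own index `F p k` of `w` over each `e k`.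
-/
theorem compress_tmulMatrix_diagonal {V W : Type*} [Ring V] [Algebra ℂ V] [AddCommGroup W]
    [Module ℂ W] {n l : ℕ} {ι : Type*} (e : Fin n → V) (w : Matrix (Fin l) (Fin l) W)
    (F : ι → Fin n → Fin l) :
    compress (of fun (p : ι) (s : Fin n × Fin l) => if s.2 = F p s.1 then (1 : ℂ) else 0)
        (tmulMatrix (diagonal e) w) =
      of fun p q => ∑ k, e k ⊗ₜ[ℂ] w (F p k) (F q k) := by
  ext p q
  simp only [compress, tmulMatrix, of_apply, Fintype.sum_prod_type, diagonal_apply]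
  refine Finset.sum_congr rfl fun k _ => ?_
  simp [TensorProduct.ite_tmul, Finset.sum_ite_eq, apply_ite star, ite_smul]

theorem diagonal_single_mem_cstarMatrixPos (n : ℕ) :
    (diagonal fun k : Fin n => (Pi.single k 1 : Fin n → ℂ)) ∈
      cstarMatrixPos (Fin n → ℂ) n := by
  refine ⟨diagonal fun k : Fin n => (Pi.single k 1 : Fin n → ℂ), ?_⟩
  rw [diagonal_conjTranspose, diagonal_mul_diagonal]
  congr 1
  ext k j
  by_cases h : j = k <;> simp [h]

/-- Over `ℂ` a form with real values is automatically Hermitian. -/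
theorem posSemidef_of_dotProduct_mulVec_nonneg {κ : Type*} [Fintype κ] [DecidableEq κ]
    {M : Matrix κ κ ℂ} (h : ∀ c : κ → ℂ, 0 ≤ star c ⬝ᵥ M *ᵥ c) : M.PosSemidef := by
  rw [← Matrix.isPositive_toEuclideanLin_iff, LinearMap.isPositive_iff_complex]
  intro x
  have hx : ⟪toEuclideanLin M x, x⟫_ℂ = star (star (ofLp x) ⬝ᵥ M *ᵥ ofLp x) := by
    rw [← inner_conj_symm, ← Complex.star_def]
    congr 1
    rw [dotProduct_comm, ← EuclideanSpace.inner_toLp_toLp]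
    rfl
  have h0 := Complex.nonneg_iff.1 (h (ofLp x))
  rw [hx]
  refine ⟨?_, by simpa using h0.1⟩
  apply Complex.ext <;> simp [← h0.2]

theorem exists_norm_sq_smul_one_sub_eq_star_mul_self {A : Type*} [CStarAlgebra A] (x : A) :
    ∃ z : A, ((‖x‖ ^ 2 : ℝ) : ℂ) • (1 : A) - star x * x = star z * z := by
  let _ := CStarAlgebra.spectralOrder A
  let _ := CStarAlgebra.spectralOrderedRing A
  have h := sub_nonneg.2 (CStarAlgebra.star_mul_le_algebraMap_norm_sq (a := x))
  obtain ⟨z, hz⟩ := CStarAlgebra.nonneg_iff_eq_star_mul_self.1 h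
  refine ⟨z, ?_⟩
  rw [← hz, Algebra.algebraMap_eq_smul_one, Complex.coe_smul]

/-! ### Positivity and norm of the trace. -/

variable {tr : predual R}

theorem toPredual_one (tr : predual R) : toPredual tr 1 = tr := by
  ext x
  simp [toPredual]

namespace IsTracialState

/-- Traciality moves `d_i*` from the right end to the left, so the quadratic form at `Y* Y` becomes
a sum of values `tr(X_r* X_r)`. -/
theorem mul_star_mem_pos (htr : IsTracialState tr) {l : ℕ} (d : Fin l → R.toStarSubalgebra) :
    (of fun i j => toPredual tr (d j * star (d i))) ∈ (ofPredual R).pos l := by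
  rintro m _ ⟨Y, rfl⟩
  refine posSemidef_of_dotProduct_mulVec_nonneg fun c => ?_
  let X : Fin m → R.toStarSubalgebra := fun r => ∑ b, ∑ j, c (b, j) • (Y r b * d j)
  have h : ∑ r, tr.1 (star (X r) * X r) =
      star c ⬝ᵥ amplify (of fun i j => toPredual tr (d j * star (d i))) (Yᴴ * Y) *ᵥ c := by
    have hX : ∀ r, tr.1 (star (X r) * X r) = ∑ a, ∑ i, ∑ b, ∑ j,
        star (c (a, i)) * c (b, j) * tr.1 (star (Y r a) * Y r b * (d j * star (d i))) := by
      intro r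
      simp only [X, star_sum, Finset.sum_mul]
      simp only [Finset.mul_sum, map_sum]
      refine Finset.sum_congr rfl fun a _ => Finset.sum_congr rfl fun i _ =>
        Finset.sum_congr rfl fun b _ => Finset.sum_congr rfl fun j _ => ?_
      rw [star_smul, smul_mul_smul_comm, map_smul, smul_eq_mul, star_mul]
      have h := htr.map_mul_comm (star (d i)) (star (Y r a) * Y r b * d j)
      simp only [mul_assoc] at h ⊢
      rw [h]
    simp only [hX, dotProduct, mulVec, Fintype.sum_prod_type, amplify, of_apply, mul_apply,
      Pi.star_apply, conjTranspose_apply, toPredual, translateFunctional_apply, Finset.sum_mul,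
      map_sum, Finset.mul_sum]
    rw [Finset.sum_comm]
    refine Finset.sum_congr rfl fun a _ => ?_
    rw [Finset.sum_comm]
    refine Finset.sum_congr rfl fun i _ => ?_
    rw [Finset.sum_comm]
    refine Finset.sum_congr rfl fun b _ => ?_
    rw [Finset.sum_comm]
    refine Finset.sum_congr rfl fun j _ => Finset.sum_congr rfl fun r _ => ?_
    ring
  rw [← h]
  exact Finset.sum_nonneg fun r _ => htr.pos _

theorem of_mem_pos (htr : IsTracialState tr) :
    (of fun _ _ => tr) ∈ (ofPredual R).pos 1 := by
  have h := htr.mul_star_mem_pos (l := 1) fun _ => 1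
  simpa [toPredual_one] using h

theorem map_star (htr : IsTracialState tr) (x : R.toStarSubalgebra) :
    tr.1 (star x) = star (tr.1 x) := by
  -- This `Y` gives `Y* Y` with rows `1, x` and `x*, x* x`.
  have h := (htr.of_mem_pos 2 _ ⟨!![1, x; 0, 0], rfl⟩).isHermitian.apply (1, 0) (0, 0)
  simpa [amplify, mul_apply] using h.symm

theorem norm_apply_sq_le (htr : IsTracialState tr) (x : R.toStarSubalgebra) :
    ((‖tr.1 x‖ ^ 2 : ℝ) : ℂ) ≤ tr.1 (star x * x) := by
  have hdet := ((htr.of_mem_pos 2 _ ⟨!![1, x; 0, 0], rfl⟩).submatrix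
    (fun i : Fin 2 => (i, 0))).det_nonneg
  have h : tr.1 x * star (tr.1 x) = ((‖tr.1 x‖ ^ 2 : ℝ) : ℂ) := by
    rw [Complex.star_def, Complex.mul_conj, Complex.normSq_eq_norm_sq]
  rw [← h, ← htr.map_star, ← sub_nonneg]
  simpa [det_fin_two, amplify, mul_apply, htr.map_one] using hdet

/-- Cauchy–Schwarz and positivity of `‖x‖² - x* x` give `|tr x|² ≤ tr(x* x) ≤ ‖x‖²`. -/
theorem norm_le_one (htr : IsTracialState tr) : ‖tr.1‖ ≤ 1 := by
  refine ContinuousLinearMap.opNorm_le_bound _ zero_le_one fun x => ?_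
  obtain ⟨z, hz⟩ := exists_norm_sq_smul_one_sub_eq_star_mul_self x
  have h := htr.pos z
  rw [← hz, map_sub, sub_nonneg, map_smul, htr.map_one, smul_eq_mul, mul_one] at h
  rw [one_mul]
  exact le_of_sq_le_sq (Complex.real_le_real.1 ((htr.norm_apply_sq_le x).trans h)) (norm_nonneg _)

end IsTracialState

/-! ### The two bounds. -/

theorem one_tmul_eq_compress (n : ℕ) (tr : predual R) :
    (of fun _ _ : Fin 1 => (1 : Fin n → ℂ) ⊗ₜ[ℂ] tr) =
      compress (of fun _ _ => 1) (tmulMatrix (1 : Matrix (Fin 1) (Fin 1) (Fin n → ℂ))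
        (of fun _ _ : Fin 1 => tr)) := by
  ext p q
  simp [compress, tmulMatrix, Fintype.sum_prod_type]

theorem one_tmul_mem_deltaCone (n : ℕ) (htr : IsTracialState tr) :
    (of fun _ _ : Fin 1 => (1 : Fin n → ℂ) ⊗ₜ[ℂ] tr) ∈
      deltaCone (ofCStarAlgebra (Fin n → ℂ)) (ofPredual R) (Fin 1) :=
  ⟨1, 1, 1, _, _, one_mem_cstarMatrixPos _ 1, htr.of_mem_pos, one_tmul_eq_compress n tr⟩

theorem deltaAbs_one_tmul_le (n : ℕ) (htr : IsTracialState tr) :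
    deltaAbs (ofCStarAlgebra (Fin n → ℂ)) (ofPredual R)
      (of fun _ _ : Fin 1 => (1 : Fin n → ℂ) ⊗ₜ[ℂ] tr) ≤ 1 := by
  have hα : ‖(of fun _ _ => 1 : Matrix (Fin 1) (Fin 1 × Fin 1) ℂ)‖ ^ 2 = 1 := by
    have h : (of fun _ _ => 1 : Matrix (Fin 1) (Fin 1 × Fin 1) ℂ)ᴴ *
        (of fun _ _ => 1 : Matrix (Fin 1) (Fin 1 × Fin 1) ℂ) = 1 := by
      ext p q
      rw [Subsingleton.elim p q, one_apply_eq]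
      simp [mul_apply]
    rw [sq, ← l2_opNorm_conjTranspose_mul_self, h, CStarRing.norm_one]
  refine csInf_le_of_le ⟨0, ?_⟩ ⟨1, 1, 1, _, _, one_mem_cstarMatrixPos _ 1, htr.of_mem_pos,
    one_tmul_eq_compress n tr, rfl⟩ ?_
  · rintro x ⟨k, l, v, w, α, -, -, -, rfl⟩
    exact mul_nonneg (mul_nonneg (sq_nonneg _) (cstarMatrixNorm_nonneg v))
      (ofPredual_norm_nonneg w)
  · rw [hα, one_mul]
    refine mul_le_one₀ (cstarMatrixNorm_one_le 1) (ofPredual_norm_nonneg _)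
      ((ofPredual_norm_le _).trans ?_)
    simpa using htr.norm_le_one

theorem sum_single_tmul {n : ℕ} (ω : predual R) :
    ∑ k : Fin n, (Pi.single k 1 : Fin n → ℂ) ⊗ₜ[ℂ] ω = 1 ⊗ₜ[ℂ] ω := by
  rw [← TensorProduct.sum_tmul]
  congr 1
  exact Finset.univ_sum_single (1 : Fin n → ℂ)

theorem star_toPredual (htr : IsTracialState tr) (x : R.toStarSubalgebra) :
    star (toPredual tr x) = toPredual tr (star x) := by
  ext y
  change star (tr.1 (star y * x)) = tr.1 (y * star x)
  rw [← htr.map_star, star_mul, star_star, htr.map_mul_comm]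

theorem fromBlocks_mem_deltaCone (htr : IsTracialState tr) {n : ℕ}
    (u : Fin n → unitary R.toStarSubalgebra) :
    fromBlocks (of fun _ _ : Fin 1 => (1 : Fin n → ℂ) ⊗ₜ[ℂ] tr)
      (of fun _ _ : Fin 1 => ∑ k : Fin n, (Pi.single k 1 : Fin n → ℂ) ⊗ₜ[ℂ]
        toPredual tr (u k : R.toStarSubalgebra))
      (of fun _ _ : Fin 1 => ∑ k : Fin n, (Pi.single k 1 : Fin n → ℂ) ⊗ₜ[ℂ]
        toPredual tr (u k : R.toStarSubalgebra))ᴴ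
      (of fun _ _ : Fin 1 => (1 : Fin n → ℂ) ⊗ₜ[ℂ] tr) ∈
      deltaCone (ofCStarAlgebra (Fin n → ℂ)) (ofPredual R) (Fin 1 ⊕ Fin 1) := by
  -- The first block row selects `d_0 = 1` over every `e_k`, the second selects `d_{k+1} = u_k`;
  -- entry `(p, q)` is then `∑ e_k ⊗ tr(· d_{F q k} d_{F p k}*)`.
  let d : Fin (n + 1) → R.toStarSubalgebra := Fin.cons 1 fun k => (u k : R.toStarSubalgebra)
  let F : Fin 1 ⊕ Fin 1 → Fin n → Fin (n + 1) := Sum.elim (fun _ _ => 0) fun _ k => k.succ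
  refine ⟨n, n + 1, _, _, of fun p s => if s.2 = F p s.1 then 1 else 0,
    diagonal_single_mem_cstarMatrixPos n, htr.mul_star_mem_pos d, ?_⟩
  rw [compress_tmulMatrix_diagonal]
  have hstar : ∀ k, star (Pi.single k 1 : Fin n → ℂ) = Pi.single k 1 := fun k => by
    rw [← Pi.single_star, star_one]
  ext (p | p) (q | q)
  · simp [F, d, toPredual_one, sum_single_tmul]
  · simp [F, d]
  · simp [F, d, star_sum, TensorProduct.star_tmul, hstar, star_toPredual htr]
  · simp [F, d, toPredual_one, sum_single_tmul]

theorem one_le_max_deltaAbs (htr : IsTracialState tr) {n : ℕ}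
    (u : Fin n → unitary R.toStarSubalgebra) (r : Fin n)
    {p p' : Matrix (Fin 1) (Fin 1) ((Fin n → ℂ) ⊗[ℂ] predual R)}
    (hp : p ∈ deltaCone (ofCStarAlgebra (Fin n → ℂ)) (ofPredual R) (Fin 1))
    (hp' : p' ∈ deltaCone (ofCStarAlgebra (Fin n → ℂ)) (ofPredual R) (Fin 1))
    (h : fromBlocks p
      (of fun _ _ : Fin 1 => ∑ k : Fin n, (Pi.single k 1 : Fin n → ℂ) ⊗ₜ[ℂ]
        toPredual tr (u k : R.toStarSubalgebra))
      (of fun _ _ : Fin 1 => ∑ k : Fin n, (Pi.single k 1 : Fin n → ℂ) ⊗ₜ[ℂ]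
        toPredual tr (u k : R.toStarSubalgebra))ᴴ p' ∈
      deltaCone (ofCStarAlgebra (Fin n → ℂ)) (ofPredual R) (Fin 1 ⊕ Fin 1)) :
    1 ≤ max (deltaAbs (ofCStarAlgebra (Fin n → ℂ)) (ofPredual R) p)
      (deltaAbs (ofCStarAlgebra (Fin n → ℂ)) (ofPredual R) p') := by
  have h1 := norm_sliceAt_apply_one_le_deltaAbs r hp 0
  have h2 := norm_sliceAt_apply_one_le_deltaAbs r hp' 0
  -- With `y = (1, -u_r*)` both off-diagonal terms equal `-tr 1 = -1`, and both diagonal terms are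
  -- values at `1`.
  have h3 := sum_sliceAt_nonneg r h ![Sum.inl 0, Sum.inr 0]
    ![1, -star (u r : R.toStarSubalgebra)]
  have hz : sliceAt r (∑ k : Fin n, (Pi.single k 1 : Fin n → ℂ) ⊗ₜ[ℂ]
      toPredual tr (u k : R.toStarSubalgebra)) = toPredual tr (u r : R.toStarSubalgebra) := by
    simp [Pi.single_apply]
  have hz' : sliceAt r (star (∑ k : Fin n, (Pi.single k 1 : Fin n → ℂ) ⊗ₜ[ℂ]
      toPredual tr (u k : R.toStarSubalgebra))) =
      toPredual tr (star (u r : R.toStarSubalgebra)) := by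
    simp [star_sum, TensorProduct.star_tmul, star_toPredual htr, Pi.single_apply]
  simp only [Fin.sum_univ_two, cons_val_zero, cons_val_one, fromBlocks_apply₁₁,
    fromBlocks_apply₁₂, fromBlocks_apply₂₁, fromBlocks_apply₂₂, conjTranspose_apply, of_apply,
    hz, hz'] at h3
  have h4 : 0 ≤ (sliceAt r (p 0 0) : predual R).1 1 + -1 +
      (-1 + (sliceAt r (p' 0 0) : predual R).1 1) := by
    simpa [toPredual, htr.map_one] using h3
  have h5 := (Complex.le_def.1 h4).1
  simp only [Complex.zero_re, Complex.add_re, Complex.neg_re, Complex.one_re] at h5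
  have h6 := (Complex.re_le_norm _).trans h1
  have h7 := (Complex.re_le_norm _).trans h2
  rw [le_max_iff]
  by_contra! hlt
  linarith [hlt.1, hlt.2]

end DeltaTensor
end

theorem mainTheorem10 {H : Type*} [NormedAddCommGroup H] [InnerProductSpace ℂ H]
    [CompleteSpace H] (R : VonNeumannAlgebra H) (hfactor : DeltaTensor.IsFactor R)
    (hfinite : DeltaTensor.IsFinite R) (tr : DeltaTensor.predual R)
    (htr : DeltaTensor.IsTracialState tr) (n : ℕ) (hn : 1 ≤ n)
    (u : Fin n → unitary R.toStarSubalgebra) :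
    DeltaTensor.deltaNorm (DeltaTensor.ofCStarAlgebra (Fin n → ℂ)) (DeltaTensor.ofPredual R)
      (∑ k : Fin n, TensorProduct.tmul ℂ (Pi.single k 1 : Fin n → ℂ)
        (DeltaTensor.toPredual tr (u k : R.toStarSubalgebra))) = 1 := by
  have hmem := DeltaTensor.one_tmul_mem_deltaCone n htr
  have hone := DeltaTensor.deltaAbs_one_tmul_le n htr
  have hblock := DeltaTensor.fromBlocks_mem_deltaCone htr u
  -- The lower bound on admissible values is used twice: for boundedness below and for the infimum
  -- itself.
  refine le_antisymm
    (csInf_le_of_le ⟨1, ?_⟩ ⟨_, _, hmem, hmem, hblock, rfl⟩ (max_le hone hone))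
    (le_csInf ⟨_, _, _, hmem, hmem, hblock, rfl⟩ ?_) <;>
  · rintro _ ⟨p, p', hp, hp', h, rfl⟩
    exact DeltaTensor.one_le_max_deltaAbs htr u ⟨0, hn⟩ hp hp' h
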